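/- **Setting.** Let $K$ be a field that is complete with respect to a non-trivial non-Archimedean absolute value $|\cdot|$. Let $X$ be a set and $\mathcal{A}$ an algebra of subsets of $X$ that is covering and separating (every point lies in a member of $\mathcal A$, and for $a\ne b$ in $X$ there is $A\in\mathcal A$ with $a\in A$, $b\notin A$). Let $\mu:\mathcal A\to K$ be a measure, that is: 1. $\mu(A\cup B)=\mu(A)+\mu(B)$ for disjoint $A,B\in\mathcal A$; 2. $\|A\|_\mu=\sup\{|\mu(B)|: B\subset A,\ B\in\mathcal A\}<\infty$ for $A\in\mathcal A$; 3. if $\mathcal A_0\subset\mathcal A$ is non-empty, closed under finite intersections and $\bigcap_{A\in\mathcal A_0}A=\varnothing$, then $\lim_{A\in\mathcal A_0}\mu(A)=0$, i.e. for each $\epsilon>0$ there is $A_\epsilon\in\mathcal A_0$ with $|\mu(A)|<\epsilon$ for all $A\in\mathcal A_0$ with $A\subset A_\epsilon$. Put $N_\mu(x)=\inf\{\|A\|_\mu: x\in A\in\mathcal A\}$. Let $\mathcal A_\mu$ be the family of all $A\subset X$ such that for each $\epsilon>0$ there is $B_\epsilon\in\mathcal A$ with $N_\mu\le\epsilon$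 on $A\,\Delta\, B_\epsilon$, and extend $\mu$ to $\mathcal A_\mu$ by $\mu(A)=\lim_{\epsilon\to0}\mu(B_\epsilon)$. Let ${}^*$ be the nonstandard extension given by the ultrapower along a countably incomplete ultrafilter on an arbitrary index set (so that it is countably saturated), and let $({}^*X,{}^*\mathcal A,{}^*\mu)$ be the internal measure space, with $\|B\|_{{}^*\mu}=\sup\{|{}^*\mu(C)|: C\subset B,\ C\in{}^*\mathcal A\}\in{}^*\mathbb R$ for $B\in{}^*\mathcal A$ and $N_{{}^*\mu}(y)=\inf\{\|B\|_{{}^*\mu}: y\in B\in{}^*\mathcal A\}\in{}^*\mathbb R$ for $y\in{}^*X$. For a topological space $T$, the monad of $a\in T$ is the intersection of all ${}^*O$ with $O$ open and $a\in O$; a point of ${}^*T$ is nearstandard if it lies in some monad; if $T$ is Hausdorff, $\mathrm{st}_T$ sends a nearstandard point to the $a\in T$ in whose monad it lies. A set $S\subset{}^*X$ is a Loeb null set if $N_{{}^*\mu}(y)\approx0$ for all $y\in S$, and it is Loeb measurable ($S\in{}^*\mathcal A_L$) if $S\,\Delta\, B$ is a Loeb null set for some $B\in{}^*\mathcal A$.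 **Theorem.** Assume that ${}^*\mu(B)\in{}^*K$ is nearstandard for all $B\in{}^*\mathcal A$, so that the Loeb measure ${}^*\mu_L(S)=\mathrm{st}_K({}^*\mu(B))$, where $B\in{}^*\mathcal A$ and $S\,\Delta\,B$ is a Loeb null set, is defined on ${}^*\mathcal A_L$. Let $X$ carry the topology generated by $\mathcal A$, or the one generated by $\mathcal A_\mu$. Then: 1. the standard-part map $\mathrm{st}_X$ is defined outside a Loeb null set: the set of points of ${}^*X$ that are not nearstandard is a Loeb null set; 2. $\mathrm{st}_X$ is measurable: $\mathrm{st}_X^{-1}(A)\in{}^*\mathcal A_L$ for every $A\in\mathcal A_\mu$; 3. $\mathrm{st}_X$ is measure-preserving: for every $A\in\mathcal A_\mu$ the limit defining $\mu(A)$ exists, and ${}^*\mu_L(\mathrm{st}_X^{-1}(A))=\mu(A)$, where the value ${}^*\mu_L(\mathrm{st}_X^{-1}(A))=\mathrm{st}_K({}^*\mu(B))$ is the same for every admissible $B$. -/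

import Mathlib

open Filter Topology

noncomputable section

namespace NonarchLoeb

variable {I X K : Type*}

/-! ### Measures with values in a non-Archimedean field -/

section Standard

variable [NormedField K]

/-- A family of sets is covering and separating: every point lies in a member of the family, and
any two distinct points `a`, `b` admit a member containing `a` but not `b`. -/
structure IsCoveringSeparating (R : Set (Set X)) : Prop where
  covering : ∀ a : X, ∃ A ∈ R, a ∈ A
  separating : ∀ a b : X, a ≠ b → ∃ A ∈ R, a ∈ A ∧ b ∉ A

/-- `μ` is a `K`-valued measure on the ring of sets `R`. Only the values of `μ` on members of `R`
matter. Continuity says `lim_{A ∈ R₀} μ A = 0` for every shrinking family `R₀` with empty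
intersection, the family being directed downwards by inclusion. -/
structure IsMeasure (R : Set (Set X)) (μ : Set X → K) : Prop where
  additive : ∀ A ∈ R, ∀ B ∈ R, Disjoint A B → μ (A ∪ B) = μ A + μ B
  bounded : ∀ A ∈ R, BddAbove {r : ℝ | ∃ B ∈ R, B ⊆ A ∧ r = ‖μ B‖}
  continuous : ∀ R₀ : Set (Set X), R₀ ⊆ R → R₀.Nonempty →
    (∀ A ∈ R₀, ∀ B ∈ R₀, A ∩ B ∈ R₀) → ⋂₀ R₀ = ∅ →
    ∀ ε : ℝ, 0 < ε → ∃ A ∈ R₀, ∀ B ∈ R₀, B ⊆ A → ‖μ B‖ < ε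

/-- `‖A‖_μ = sup {|μ B| : B ⊆ A, B ∈ R}`. -/
def setNorm (R : Set (Set X)) (μ : Set X → K) (A : Set X) : ℝ :=
  sSup {r : ℝ | ∃ B ∈ R, B ⊆ A ∧ r = ‖μ B‖}

/-- The norm function `N_μ x = inf {‖A‖_μ : x ∈ A ∈ R}`. -/
def normFun (R : Set (Set X)) (μ : Set X → K) (x : X) : ℝ :=
  sInf {r : ℝ | ∃ A ∈ R, x ∈ A ∧ r = setNorm R μ A}

/-- `B` approximates `A` up to `ε`: `N_μ ≤ ε` on the symmetric difference of `A` and `B`. -/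
def Approximates (R : Set (Set X)) (μ : Set X → K) (A B : Set X) (ε : ℝ) : Prop :=
  ∀ x ∈ symmDiff A B, normFun R μ x ≤ ε

/-- The extended ring `R_μ`: the sets that members of `R` approximate up to every `ε > 0`. -/
def extendedRing (R : Set (Set X)) (μ : Set X → K) : Set (Set X) :=
  {A | ∀ ε : ℝ, 0 < ε → ∃ B ∈ R, Approximates R μ A B ε}

/-- `A` belongs to the extended ring and `c` is the value at `A` of the measure extended to
`R_μ`, that is, `c = lim_{ε → 0} μ B_ε` for `B_ε ∈ R` approximating `A` up to `ε`. -/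
def HasExtendedMeasure (R : Set (Set X)) (μ : Set X → K) (A : Set X) (c : K) : Prop :=
  A ∈ extendedRing R μ ∧
    ∀ η : ℝ, 0 < η → ∃ δ : ℝ, 0 < δ ∧
      ∀ ε : ℝ, 0 < ε → ε ≤ δ → ∀ B ∈ R, Approximates R μ A B ε → ‖μ B - c‖ < η

end Standard

/-! ### The nonstandard extension: ultrapowers -/

/-- The nonstandard extension `*X`: the ultrapower of `X` along `U`. -/
abbrev Star (U : Ultrafilter I) (X : Type*) : Type _ := (U : Filter I).Germ X

variable (U : Ultrafilter I)

/-- The extension `*A ⊆ *X` of a standard set `A ⊆ X`. -/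
def starSet (A : Set X) : Set (Star U X) := {y | Germ.LiftPred (fun x => x ∈ A) y}

variable {U} in
/-- The internal subset of `*X` represented by an element `b` of `*(Set X)`: a point `[xᵢ]` belongs
to `[bᵢ]` iff `xᵢ ∈ bᵢ` for `U`-almost all `i`. -/
def internalSet (b : Star U (Set X)) : Set (Star U X) :=
  {y | Germ.LiftRel (fun x B => x ∈ B) y b}

/-- The monad of `a` for the topology `τ`: the intersection of all `*O`, `O` open, `a ∈ O`. -/
def monad (τ : TopologicalSpace X) (a : X) : Set (Star U X) :=
  {y | ∀ O : Set X, IsOpen[τ] O → a ∈ O → y ∈ starSet U O}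

/-- The nearstandard points `ns(*X)`. -/
def nearstandard (τ : TopologicalSpace X) : Set (Star U X) := {y | ∃ a : X, y ∈ monad U τ a}

/-- The standard-part map `st : ns(*X) → X`, sending `y` to the point in whose monad it lies (this
point is unique if `τ` is Hausdorff). -/
def standardPart (τ : TopologicalSpace X) (y : nearstandard U τ) : X := y.2.choose

/-- The preimage of `A` under the standard-part map, as a subset of `*X`. -/
def stPreimage (τ : TopologicalSpace X) (A : Set X) : Set (Star U X) :=
  Subtype.val '' (standardPart U τ ⁻¹' A)

variable {U} in
/-- A hyperreal number is infinitesimal, `r ≈ 0`. -/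
def Infinitesimal (r : Star U ℝ) : Prop := r ∈ monad U inferInstance (0 : ℝ)

variable {U} in
open Classical in
/-- The supremum of a set of hyperreals that has one (and `0` otherwise). -/
def hyperSup (S : Set (Star U ℝ)) : Star U ℝ := if h : ∃ r, IsLUB S r then h.choose else 0

variable {U} in
open Classical in
/-- The infimum of a set of hyperreals that has one (and `0` otherwise). -/
def hyperInf (S : Set (Star U ℝ)) : Star U ℝ := if h : ∃ r, IsGLB S r then h.choose else 0

/-! ### The internal measure space `(*X, *R, *μ)` and its Loeb space -/

section Loeb

variable [NormedField K] (R : Set (Set X)) (μ : Set X → K)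

/-- The internal ring `*R`, as a set of elements of `*(Set X)`. -/
def starRing : Set (Star U (Set X)) := starSet U R

variable {U} in
/-- The internal measure `*μ`. -/
def starMeasure (b : Star U (Set X)) : Star U K := Germ.map μ b

variable {U} in
/-- `‖b‖_{*μ}`, the supremum in `*ℝ` of `|*μ c|` over all `c ∈ *R` contained in `b`. -/
def starSetNorm (b : Star U (Set X)) : Star U ℝ :=
  hyperSup {r | ∃ c ∈ starRing U R, internalSet c ⊆ internalSet b ∧
    r = Germ.map (fun z : K => ‖z‖) (starMeasure μ c)}

variable {U} in
/-- The norm function `N_{*μ} : *X → *ℝ`, the infimum in `*ℝ` of `‖b‖_{*μ}` over all `b ∈ *R`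
containing `y`. -/
def starNormFun (y : Star U X) : Star U ℝ :=
  hyperInf {r | ∃ b ∈ starRing U R, y ∈ internalSet b ∧ r = starSetNorm R μ b}

variable {U} in
/-- A (possibly external) set `S ⊆ *X` is a Loeb null set if `N_{*μ} y ≈ 0` for all `y ∈ S`. -/
def IsLoebNull (S : Set (Star U X)) : Prop := ∀ y ∈ S, Infinitesimal (starNormFun R μ y)

/-- The ring `*R_L` of Loeb measurable sets: the sets that differ from an internal set in `*R` by a
Loeb null set. -/
def loebRing : Set (Set (Star U X)) :=
  {S | ∃ b ∈ starRing U R, IsLoebNull R μ (symmDiff S (internalSet b))}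

variable {U} in
/-- `S` is Loeb measurable and `c` is its Loeb measure: `st_K (*μ b) = c` for every `b ∈ *R` that
differs from `S` by a Loeb null set. -/
def HasLoebMeasure (S : Set (Star U X)) (c : K) : Prop :=
  S ∈ loebRing U R μ ∧ ∀ b ∈ starRing U R, IsLoebNull R μ (symmDiff S (internalSet b)) →
    starMeasure μ b ∈ monad U inferInstance c

end Loeb

end NonarchLoeb

end

namespace NonarchLoeb

open MeasureTheory

variable {I X K : Type*}

/-! ### Ultrametric measures and their extension -/

section Standard

variable [NormedField K] {R : Set (Set X)} {μ : Set X → K}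

/-! Let `y` have non-infinitesimal norm. The sets `A ∈ R` with `y ∈ *A` form an ultrafilter of the
algebra `R`. If its intersection were empty, continuity and the ultrametric inequality would give
members of arbitrarily small norm, making the norm of `y` infinitesimal; any point of the
intersection has `y` in its monad (`exists_mem_monad_generateFrom`).

If `N(y) ≥ ε`, its standard part `a` also has `N(a) ≥ ε`. Where `N ≥ ε`, a set of the extended ring
agrees with some member of `R`, which is clopen, so `y ∈ *A ↔ a ∈ A`
(`mem_starSet_iff_of_mem_monad`). Thus the preimage of `A` is `*A` up to a null set, and `*A` is
internally approximated by `B_n` with `n` infinite.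

The values match because `N ≤ ε` on `D ∈ R` forces `‖μ D‖ ≤ ε` (`norm_le_of_normFun_le`): internal
sets differing by a null set have infinitely close measures. -/

lemma IsMeasure.empty (hR : IsSetAlgebra R) (hμ : IsMeasure R μ) : μ ∅ = 0 := by
  have h := hμ.additive ∅ hR.empty_mem ∅ hR.empty_mem disjoint_bot_left
  rw [Set.union_self] at h
  exact left_eq_add.mp h

lemma IsMeasure.inter_add_diff (hR : IsSetAlgebra R) (hμ : IsMeasure R μ) {A B : Set X}
    (hA : A ∈ R) (hB : B ∈ R) : μ A = μ (A ∩ B) + μ (A \ B) := by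
  rw [← hμ.additive _ (hR.isSetRing.inter_mem hA hB) _ (hR.isSetRing.sdiff_mem hA hB)
    Set.disjoint_sdiff_inter.symm, Set.inter_union_sdiff]

lemma IsMeasure.norm_le_setNorm (hμ : IsMeasure R μ) {A B : Set X}
    (hA : A ∈ R) (hB : B ∈ R) (hBA : B ⊆ A) : ‖μ B‖ ≤ setNorm R μ A :=
  le_csSup (hμ.bounded A hA) ⟨B, hB, hBA, rfl⟩

lemma setNorm_nonneg (A : Set X) : 0 ≤ setNorm R μ A := by
  apply Real.sSup_nonneg
  rintro r ⟨B, -, -, rfl⟩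
  exact norm_nonneg _

lemma setNorm_le {A : Set X} {r : ℝ} (hr : 0 ≤ r) (h : ∀ B ∈ R, B ⊆ A → ‖μ B‖ ≤ r) :
    setNorm R μ A ≤ r := by
  apply Real.sSup_le _ hr
  rintro s ⟨B, hB, hBA, rfl⟩
  exact h B hB hBA

lemma normFun_nonneg (x : X) : 0 ≤ normFun R μ x := by
  apply Real.sInf_nonneg
  rintro r ⟨A, -, -, rfl⟩
  exact setNorm_nonneg A

lemma normFun_bddBelow (x : X) : BddBelow {r : ℝ | ∃ A ∈ R, x ∈ A ∧ r = setNorm R μ A} := by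
  refine ⟨0, ?_⟩
  rintro r ⟨A, -, -, rfl⟩
  exact setNorm_nonneg A

lemma normFun_le_setNorm {A : Set X} (hA : A ∈ R) {x : X} (hx : x ∈ A) :
    normFun R μ x ≤ setNorm R μ A :=
  csInf_le (normFun_bddBelow x) ⟨A, hA, hx, rfl⟩

lemma exists_setNorm_lt (hR : IsSetAlgebra R) {x : X} {r : ℝ} (h : normFun R μ x < r) :
    ∃ A ∈ R, x ∈ A ∧ setNorm R μ A < r := by
  -- The whole space is a competitor, so the infimum is not the default value of `sInf ∅`.
  obtain ⟨s, ⟨A, hA, hx, rfl⟩, hs⟩ := exists_lt_of_csInf_lt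
    (⟨_, Set.univ, hR.univ_mem, Set.mem_univ x, rfl⟩ :
      {r : ℝ | ∃ A ∈ R, x ∈ A ∧ r = setNorm R μ A}.Nonempty) h
  exact ⟨A, hA, hx, hs⟩

lemma le_normFun (hR : IsSetAlgebra R) {x : X} {r : ℝ}
    (h : ∀ A ∈ R, x ∈ A → r ≤ setNorm R μ A) : r ≤ normFun R μ x := by
  by_contra! hlt
  obtain ⟨A, hA, hx, hs⟩ := exists_setNorm_lt hR hlt
  exact absurd (h A hA hx) (not_le.mpr hs)

lemma subset_extendedRing : R ⊆ extendedRing R μ := by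
  intro A hA ε _
  refine ⟨A, hA, ?_⟩
  intro x hx
  simp at hx

variable [IsUltrametricDist K]

lemma norm_sub_le_max_norm (x y : K) :
    ‖x - y‖ ≤ max ‖x‖ ‖y‖ := by
  simpa [sub_eq_add_neg] using IsUltrametricDist.norm_add_le_max x (-y)

lemma setNorm_union_le (hR : IsSetAlgebra R) (hμ : IsMeasure R μ) {A B : Set X}
    (hA : A ∈ R) (hB : B ∈ R) : setNorm R μ (A ∪ B) ≤ max (setNorm R μ A) (setNorm R μ B) := by
  apply setNorm_le (le_max_of_le_left (setNorm_nonneg A))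
  intro C hC hCAB
  rw [hμ.inter_add_diff hR hC hA]
  refine (IsUltrametricDist.norm_add_le_max _ _).trans (max_le_max ?_ ?_)
  · exact hμ.norm_le_setNorm hA (hR.isSetRing.inter_mem hC hA) Set.inter_subset_right
  · exact hμ.norm_le_setNorm hB (hR.isSetRing.sdiff_mem hC hA) (Set.sdiff_subset_iff.mpr hCAB)

/-- A bound for the norm function on a set bounds the measure of the set. -/
lemma norm_le_of_normFun_le (hR : IsSetAlgebra R) (hμ : IsMeasure R μ) {D : Set X} (hD : D ∈ R)
    {ε : ℝ} (hε : 0 ≤ ε) (h : ∀ x ∈ D, normFun R μ x ≤ ε) : ‖μ D‖ ≤ ε := by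
  -- The infimum `N(x)` need not be attained, so some room `δ > ε` is needed. The sets `D \ E` with
  -- `‖E‖ ≤ δ` shrink to `∅`, since such `E` cover `D` and are closed under unions; continuity makes
  -- some `μ (D \ E)` small.
  refine le_of_forall_gt_imp_ge_of_dense fun δ hδ => ?_
  obtain ⟨_, ⟨E, hE, hEδ, rfl⟩, hlt⟩ := hμ.continuous {C | ∃ E ∈ R, setNorm R μ E ≤ δ ∧ C = D \ E}
    (by rintro _ ⟨E, hE, -, rfl⟩; exact hR.isSetRing.sdiff_mem hD hE)
    ⟨_, ∅, hR.empty_mem, setNorm_le (hε.trans hδ.le) (by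
      intro B _ hB
      rw [Set.subset_empty_iff.mp hB, hμ.empty hR, norm_zero]
      exact hε.trans hδ.le), rfl⟩
    (by
      rintro _ ⟨E, hE, hEδ, rfl⟩ _ ⟨F, hF, hFδ, rfl⟩
      exact ⟨E ∪ F, hR.union_mem hE hF, (setNorm_union_le hR hμ hE hF).trans (max_le hEδ hFδ),
        Set.sdiff_inter_sdiff⟩)
    (by
      refine Set.eq_empty_of_forall_notMem fun x hx => ?_
      have hxD : x ∈ D := by
        refine (hx (D \ ∅) ⟨∅, hR.empty_mem, setNorm_le (hε.trans hδ.le) ?_, rfl⟩).1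
        intro B _ hB
        rw [Set.subset_empty_iff.mp hB, hμ.empty hR, norm_zero]
        exact hε.trans hδ.le
      obtain ⟨E, hE, hxE, hEδ⟩ := exists_setNorm_lt hR ((h x hxD).trans_lt hδ)
      exact (hx (D \ E) ⟨E, hE, hEδ.le, rfl⟩).2 hxE)
    δ (hε.trans_lt hδ)
  rw [hμ.inter_add_diff hR hD hE]
  refine (IsUltrametricDist.norm_add_le_max _ _).trans (max_le ?_ ?_)
  · exact (hμ.norm_le_setNorm hE (hR.isSetRing.inter_mem hD hE) Set.inter_subset_right).trans hEδ
  · exact (hlt _ ⟨E, hE, hEδ, rfl⟩ subset_rfl).le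

lemma norm_sub_le_of_normFun_le (hR : IsSetAlgebra R) (hμ : IsMeasure R μ) {A B : Set X}
    (hA : A ∈ R) (hB : B ∈ R) {ε : ℝ} (hε : 0 ≤ ε)
    (h : ∀ x ∈ symmDiff A B, normFun R μ x ≤ ε) : ‖μ A - μ B‖ ≤ ε := by
  rw [hμ.inter_add_diff hR hA hB, hμ.inter_add_diff hR hB hA, Set.inter_comm B A,
    add_sub_add_left_eq_sub]
  refine (norm_sub_le_max_norm _ _).trans (max_le ?_ ?_)
  · exact norm_le_of_normFun_le hR hμ (hR.isSetRing.sdiff_mem hA hB) hε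
      fun x hx => h x (Or.inl hx)
  · exact norm_le_of_normFun_le hR hμ (hR.isSetRing.sdiff_mem hB hA) hε
      fun x hx => h x (Or.inr hx)

lemma norm_sub_le_of_approximates (hR : IsSetAlgebra R) (hμ : IsMeasure R μ) {S A B : Set X}
    (hA : A ∈ R) (hB : B ∈ R) {ε δ : ℝ} (hε : 0 ≤ ε)
    (hSA : Approximates R μ S A ε) (hSB : Approximates R μ S B δ) :
    ‖μ A - μ B‖ ≤ max ε δ := by
  refine norm_sub_le_of_normFun_le hR hμ hA hB (le_max_of_le_left hε) fun x hx => ?_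
  rcases symmDiff_triangle A S B hx with h | h
  · exact (hSA x (symmDiff_comm A S ▸ h)).trans (le_max_left _ _)
  · exact (hSB x h).trans (le_max_right _ _)

/-- The measures of a sequence of better and better approximations converge to the extended
measure. -/
lemma exists_hasExtendedMeasure [CompleteSpace K] (hR : IsSetAlgebra R) (hμ : IsMeasure R μ)
    {A : Set X} (hA : A ∈ extendedRing R μ) {B : ℕ → Set X} (hB : ∀ n, B n ∈ R)
    (hAB : ∀ n, Approximates R μ A (B n) (1 / ((n : ℝ) + 1))) :
    ∃ c, HasExtendedMeasure R μ A c ∧ Tendsto (fun n => μ (B n)) atTop (𝓝 c) := by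
  have hcauchy : CauchySeq fun n => μ (B n) := by
    refine cauchySeq_of_le_tendsto_0 (fun n : ℕ => 1 / ((n : ℝ) + 1)) (fun n m N hn hm => ?_)
      tendsto_one_div_add_atTop_nhds_zero_nat
    rw [dist_eq_norm]
    exact (norm_sub_le_of_approximates hR hμ (hB n) (hB m) (by positivity) (hAB n) (hAB m)).trans
      (max_le (Nat.one_div_le_one_div hn) (Nat.one_div_le_one_div hm))
  obtain ⟨c, hc⟩ := cauchySeq_tendsto_of_complete hcauchy
  -- Passing to the limit only gives `≤ ε`; halving `η` restores strictness.
  refine ⟨c, ⟨hA, fun η hη => ⟨η / 2, half_pos hη, fun ε hε hεη C hC hAC => ?_⟩⟩, hc⟩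
  refine lt_of_le_of_lt (b := ε) ?_ (by linarith)
  refine le_of_tendsto (tendsto_const_nhds.sub hc).norm ?_
  filter_upwards [tendsto_one_div_add_atTop_nhds_zero_nat.eventually_le_const hε] with n hn
  exact (norm_sub_le_of_approximates hR hμ hC (hB n) hε.le hAC (hAB n)).trans (max_le le_rfl hn)

end Standard

/-! ### Ultrapowers and internal sets -/

section Ultrapower

variable {U : Ultrafilter I}

/-- Given sets `s n ∈ U` with intersection outside `U`, send `i` to the first `n` with `i ∉ s n`:
this is at least `N` on `⋂ k < N, s k`. The default `0` occurs only on a `U`-negligible set. -/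
lemma exists_tendsto_atTop (hU : ¬ CountableInterFilter (U : Filter I)) :
    ∃ n : I → ℕ, Tendsto n U atTop := by
  classical
  have h : ∃ S : Set (Set I), S.Countable ∧ (∀ s ∈ S, s ∈ (U : Filter I)) ∧
      ⋂₀ S ∉ (U : Filter I) := by
    by_contra! h
    exact hU ⟨h⟩
  obtain ⟨S, hS, hSU, hnot⟩ := h
  have hne : S.Nonempty := by
    rw [Set.nonempty_iff_ne_empty]
    rintro rfl
    simp at hnot
  obtain ⟨s, rfl⟩ := hS.exists_eq_range hne
  rw [Set.sInter_range] at hnot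
  have hout : ∀ᶠ i in (U : Filter I), ∃ n, i ∉ s n := by
    have h : ∀ᶠ i in (U : Filter I), i ∉ ⋂ n, s n := Ultrafilter.eventually_not.mpr hnot
    simpa using h
  refine ⟨fun i => if h : ∃ n, i ∉ s n then Nat.find h else 0, tendsto_atTop.mpr fun N => ?_⟩
  have hin : ∀ᶠ i in (U : Filter I), ∀ k ∈ Finset.range N, i ∈ s k :=
    (Filter.eventually_all_finset _).mpr fun k _ => hSU _ ⟨k, rfl⟩
  filter_upwards [hout, hin] with i hi hi'
  rw [dif_pos hi, Nat.le_find_iff]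
  intro m hm
  simpa using hi' m (Finset.mem_range.mpr hm)

lemma coe_mem_starSet {A : Set X} {x : I → X} :
    (x : Star U X) ∈ starSet U A ↔ ∀ᶠ i in (U : Filter I), x i ∈ A := Iff.rfl

lemma coe_mem_internalSet {b : I → Set X} {x : I → X} :
    (x : Star U X) ∈ internalSet (b : Star U (Set X)) ↔ ∀ᶠ i in (U : Filter I), x i ∈ b i :=
  Iff.rfl

lemma coe_mem_monad {τ : TopologicalSpace X} {a : X} {x : I → X} :
    (x : Star U X) ∈ monad U τ a ↔ Tendsto x U (@nhds X τ a) := by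
  rw [tendsto_nhds]
  rfl

lemma infinitesimal_coe {r : I → ℝ} :
    Infinitesimal (r : Star U ℝ) ↔ Tendsto r U (𝓝 0) := coe_mem_monad

lemma not_tendsto_zero_iff {r : I → ℝ} (hr : ∀ i, 0 ≤ r i) :
    ¬ Tendsto r U (𝓝 0) ↔ ∃ ε > 0, ∀ᶠ i in (U : Filter I), ε ≤ r i := by
  simp only [Metric.tendsto_nhds, Real.dist_0_eq_abs, abs_of_nonneg (hr _), not_forall,
    ← Ultrafilter.eventually_not, not_lt, exists_prop]

lemma internalSet_subset_iff {b c : I → Set X} :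
    internalSet (c : Star U (Set X)) ⊆ internalSet (b : Star U (Set X)) ↔
      ∀ᶠ i in (U : Filter I), c i ⊆ b i := by
  constructor
  · intro h
    by_contra hn
    rw [← Ultrafilter.eventually_not] at hn
    obtain ⟨i₀, hi₀⟩ := hn.exists
    -- A filler for the coordinates where inclusion holds, as `X` is not assumed nonempty.
    obtain ⟨x₀, -⟩ := Set.not_subset.mp hi₀
    have hx : ∀ i, ∃ x, ¬ c i ⊆ b i → x ∈ c i ∧ x ∉ b i := by
      intro i
      by_cases hi : c i ⊆ b i
      · exact ⟨x₀, fun h' => absurd hi h'⟩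
      · obtain ⟨x, hx⟩ := Set.not_subset.mp hi
        exact ⟨x, fun _ => hx⟩
    choose x hx using hx
    have h1 : (x : Star U X) ∈ internalSet (b : Star U (Set X)) :=
      h (coe_mem_internalSet.mpr (hn.mono fun i hi => (hx i hi).1))
    obtain ⟨i, hi, hi'⟩ := (hn.and (coe_mem_internalSet.mp h1)).exists
    exact (hx i hi).2 hi'
  · intro h y
    induction y using Germ.inductionOn with | _ x =>
    intro hy
    filter_upwards [h, coe_mem_internalSet.mp hy] with i hi hxi using hi hxi

lemma hyperSup_eq {S : Set (Star U ℝ)} {r : Star U ℝ} (h : IsLUB S r) : hyperSup S = r := by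
  have hS : ∃ r, IsLUB S r := ⟨r, h⟩
  rw [hyperSup, dif_pos hS]
  exact hS.choose_spec.unique h

lemma hyperInf_eq {S : Set (Star U ℝ)} {r : Star U ℝ} (h : IsGLB S r) : hyperInf S = r := by
  have hS : ∃ r, IsGLB S r := ⟨r, h⟩
  rw [hyperInf, dif_pos hS]
  exact hS.choose_spec.unique h

/-! ### Internal norms and Loeb null sets -/

variable [NormedField K] {R : Set (Set X)} {μ : Set X → K}

/-- Transfer for suprema: choosing near-optimal `c i` coordinatewise yields one internal set that
tests any proposed upper bound. -/
lemma starSetNorm_coe (hR : IsSetAlgebra R) (hμ : IsMeasure R μ) {b : I → Set X}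
    (hb : ∀ᶠ i in (U : Filter I), b i ∈ R) :
    starSetNorm R μ (b : Star U (Set X)) = ((fun i => setNorm R μ (b i) : I → ℝ) : Star U ℝ) := by
  apply hyperSup_eq
  constructor
  · rintro _ ⟨c, hc, hcb, rfl⟩
    induction c using Germ.inductionOn with | _ c =>
    refine Germ.coe_le.mpr ?_
    filter_upwards [hb, coe_mem_starSet.mp hc, internalSet_subset_iff.mp hcb] with i h1 h2 h3
    exact hμ.norm_le_setNorm h1 h2 h3
  · intro r hr
    induction r using Germ.inductionOn with | _ r =>
    refine Germ.coe_le.mpr ?_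
    have hc : ∀ i, ∃ c ∈ R, c ⊆ b i ∧ (r i < setNorm R μ (b i) → r i < ‖μ c‖) := by
      intro i
      by_cases hi : r i < setNorm R μ (b i)
      · obtain ⟨_, ⟨c, hc, hcb, rfl⟩, hlt⟩ := exists_lt_of_lt_csSup
          (⟨_, ∅, hR.empty_mem, Set.empty_subset _, rfl⟩ :
            {r : ℝ | ∃ B ∈ R, B ⊆ b i ∧ r = ‖μ B‖}.Nonempty) hi
        exact ⟨c, hc, hcb, fun _ => hlt⟩
      · exact ⟨∅, hR.empty_mem, Set.empty_subset _, fun h => absurd h hi⟩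
    choose c hcR hcb hc using hc
    have h := hr ⟨(c : Star U (Set X)), Eventually.of_forall hcR,
      internalSet_subset_iff.mpr (Eventually.of_forall hcb), rfl⟩
    filter_upwards [Germ.coe_le.mp h] with i hi
    by_contra! hlt
    exact absurd hi (not_le.mpr (hc i hlt))

lemma starNormFun_coe (hR : IsSetAlgebra R) (hμ : IsMeasure R μ) (x : I → X) :
    starNormFun R μ (x : Star U X) = ((fun i => normFun R μ (x i) : I → ℝ) : Star U ℝ) := by
  apply hyperInf_eq
  constructor
  · rintro _ ⟨b, hb, hxb, rfl⟩
    induction b using Germ.inductionOn with | _ b =>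
    rw [starSetNorm_coe hR hμ (coe_mem_starSet.mp hb)]
    refine Germ.coe_le.mpr ?_
    filter_upwards [coe_mem_starSet.mp hb, coe_mem_internalSet.mp hxb] with i h1 h2
    exact normFun_le_setNorm h1 h2
  · intro r hr
    induction r using Germ.inductionOn with | _ r =>
    refine Germ.coe_le.mpr ?_
    have hb : ∀ i, ∃ b ∈ R, x i ∈ b ∧ (normFun R μ (x i) < r i → setNorm R μ b < r i) := by
      intro i
      by_cases hi : normFun R μ (x i) < r i
      · obtain ⟨b, hb, hxb, hlt⟩ := exists_setNorm_lt hR hi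
        exact ⟨b, hb, hxb, fun _ => hlt⟩
      · exact ⟨Set.univ, hR.univ_mem, Set.mem_univ _, fun h => absurd h hi⟩
    choose b hbR hxb hb using hb
    have h := hr ⟨(b : Star U (Set X)), Eventually.of_forall hbR,
      coe_mem_internalSet.mpr (Eventually.of_forall hxb), rfl⟩
    rw [starSetNorm_coe hR hμ (Eventually.of_forall hbR)] at h
    filter_upwards [Germ.coe_le.mp h] with i hi
    by_contra! hlt
    exact absurd hi (not_le.mpr (hb i hlt))

lemma infinitesimal_starNormFun_coe (hR : IsSetAlgebra R) (hμ : IsMeasure R μ) {x : I → X} :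
    Infinitesimal (starNormFun R μ (x : Star U X)) ↔
      Tendsto (fun i => normFun R μ (x i)) U (𝓝 0) := by
  rw [starNormFun_coe hR hμ, infinitesimal_coe]

lemma not_infinitesimal_starNormFun_coe (hR : IsSetAlgebra R) (hμ : IsMeasure R μ) {x : I → X} :
    ¬ Infinitesimal (starNormFun R μ (x : Star U X)) ↔
      ∃ ε > 0, ∀ᶠ i in (U : Filter I), ε ≤ normFun R μ (x i) := by
  rw [infinitesimal_starNormFun_coe hR hμ, not_tendsto_zero_iff fun i => normFun_nonneg (x i)]

/-- On an internal Loeb null set the norm function is eventually uniformly small. -/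
lemma IsLoebNull.eventually_forall_le (hR : IsSetAlgebra R) (hμ : IsMeasure R μ) {d : I → Set X}
    (hd : IsLoebNull R μ (internalSet (d : Star U (Set X)))) {ε : ℝ} (hε : 0 < ε) :
    ∀ᶠ i in (U : Filter I), ∀ x ∈ d i, normFun R μ x ≤ ε := by
  set e : I → Set X := fun i => {x | normFun R μ x ≤ ε}
  -- Inclusion of internal sets turns the pointwise bound into a uniform one.
  refine internalSet_subset_iff (b := e) |>.mp fun y => ?_
  induction y using Germ.inductionOn with | _ x =>
  intro hy
  have h := (infinitesimal_starNormFun_coe hR hμ).mp (hd _ hy)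
  exact coe_mem_internalSet.mpr (h.eventually_le_const hε)

lemma internalSet_symmDiff (b c : I → Set X) :
    symmDiff (internalSet (b : Star U (Set X))) (internalSet (c : Star U (Set X))) =
      internalSet ((fun i => symmDiff (b i) (c i) : I → Set X) : Star U (Set X)) := by
  ext y
  induction y using Germ.inductionOn with | _ x =>
  simp only [Set.mem_symmDiff, coe_mem_internalSet, Ultrafilter.eventually_or,
    Filter.eventually_and, Ultrafilter.eventually_not]

lemma IsLoebNull.mono {S T : Set (Star U X)} (hT : IsLoebNull R μ T) (h : S ⊆ T) :
    IsLoebNull R μ S := fun y hy => hT y (h hy)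

lemma IsLoebNull.union {S T : Set (Star U X)} (hS : IsLoebNull R μ S) (hT : IsLoebNull R μ T) :
    IsLoebNull R μ (S ∪ T) := fun y hy => hy.elim (hS y) (hT y)

/-- Internal sets that differ by a Loeb null set have infinitely close measures. -/
lemma starMeasure_mem_monad_of_isLoebNull [IsUltrametricDist K] (hR : IsSetAlgebra R)
    (hμ : IsMeasure R μ) {b c : Star U (Set X)} (hb : b ∈ starRing U R) (hc : c ∈ starRing U R)
    (h : IsLoebNull R μ (symmDiff (internalSet b) (internalSet c))) {k : K}
    (hk : starMeasure μ c ∈ monad U inferInstance k) :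
    starMeasure μ b ∈ monad U inferInstance k := by
  induction b using Germ.inductionOn with | _ b =>
  induction c using Germ.inductionOn with | _ c =>
  rw [internalSet_symmDiff] at h
  refine coe_mem_monad (x := fun i => μ (b i)) |>.mpr ?_
  have hk : Tendsto (fun i => μ (c i)) U (𝓝 k) := coe_mem_monad.mp hk
  have hsub : Tendsto (fun i => μ (b i) - μ (c i)) U (𝓝 0) := by
    rw [Metric.tendsto_nhds]
    intro ε hε
    filter_upwards [h.eventually_forall_le hR hμ (half_pos hε), coe_mem_starSet.mp hb,
      coe_mem_starSet.mp hc] with i hi hbi hci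
    rw [dist_zero_right]
    exact (norm_sub_le_of_normFun_le hR hμ hbi hci (half_pos hε).le hi).trans_lt (half_lt_self hε)
  simpa using hsub.add hk

/-! ### Standard parts and the Loeb space -/

/-- A point with non-infinitesimal norm lies in the monad of a standard point for the topology
generated by the ring. -/
lemma exists_mem_monad_generateFrom [IsUltrametricDist K] (hR : IsSetAlgebra R)
    (hμ : IsMeasure R μ) {y : Star U X} (hy : ¬ Infinitesimal (starNormFun R μ y)) :
    ∃ a, y ∈ monad U (TopologicalSpace.generateFrom R) a := by
  induction y using Germ.inductionOn with | _ x =>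
  by_contra! hns
  apply hy
  set F : Set (Set X) := {A | A ∈ R ∧ ∀ᶠ i in (U : Filter I), x i ∈ A}
  have hF : ∀ A ∈ R, A ∉ F → Aᶜ ∈ F := by
    intro A hA hAF
    refine ⟨hR.compl_mem hA, ?_⟩
    exact Ultrafilter.eventually_not.mpr fun h => hAF ⟨hA, h⟩
  have hempty : ⋂₀ F = ∅ := by
    refine Set.eq_empty_of_forall_notMem fun a ha => hns a ?_
    rw [coe_mem_monad, TopologicalSpace.tendsto_nhds_generateFrom_iff]
    intro A hA haA
    by_contra hAx
    exact ha Aᶜ (hF A hA fun h => hAx h.2) haA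
  rw [infinitesimal_starNormFun_coe hR hμ]
  by_contra hlim
  obtain ⟨ε, hε, hεx⟩ := (not_tendsto_zero_iff fun i => normFun_nonneg (x i)).mp hlim
  obtain ⟨A, hA, hAε⟩ := hμ.continuous F (fun A hA => hA.1)
    ⟨Set.univ, hR.univ_mem, Eventually.of_forall fun _ => Set.mem_univ _⟩
    (fun A hA B hB => ⟨hR.isSetRing.inter_mem hA.1 hB.1, hA.2.and hB.2⟩) hempty
    (ε / 2) (half_pos hε)
  -- Continuity only controls members of `F`. For `C ⊆ A` outside `F`, the difference `A \ C` is in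
  -- `F`, and `μ C = μ A - μ (A \ C)`.
  have hnorm : setNorm R μ A ≤ ε / 2 := by
    apply setNorm_le (half_pos hε).le
    intro C hC hCA
    by_cases hCF : C ∈ F
    · exact (hAε C hCF hCA).le
    · have hdiff : A \ C ∈ F :=
        ⟨hR.isSetRing.sdiff_mem hA.1 hC, hA.2.and (hF C hC hCF).2⟩
      have h := hμ.inter_add_diff hR hA.1 hC
      rw [Set.inter_eq_self_of_subset_right hCA] at h
      rw [eq_sub_of_add_eq h.symm]
      exact (norm_sub_le_max_norm _ _).trans
        (max_le (hAε A hA subset_rfl).le (hAε _ hdiff Set.sdiff_subset).le)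
  obtain ⟨i, hi, hiA⟩ := (hεx.and hA.2).exists
  have := normFun_le_setNorm (R := R) (μ := μ) hA.1 hiA
  linarith

/-- Membership in a set of the extended ring is inherited by and from the standard part, at points
with non-infinitesimal norm. -/
lemma mem_starSet_iff_of_mem_monad (hR : IsSetAlgebra R) (hμ : IsMeasure R μ) {y : Star U X}
    (hy : ¬ Infinitesimal (starNormFun R μ y)) {a : X}
    (ha : y ∈ monad U (TopologicalSpace.generateFrom R) a) {A : Set X}
    (hA : A ∈ extendedRing R μ) : y ∈ starSet U A ↔ a ∈ A := by
  induction y using Germ.inductionOn with | _ x =>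
  obtain ⟨ε, hε, hεx⟩ := (not_infinitesimal_starNormFun_coe hR hμ).mp hy
  rw [coe_mem_monad, TopologicalSpace.tendsto_nhds_generateFrom_iff] at ha
  -- Every `B ∈ R` containing `a` also contains almost all `x i`.
  have hεa : ε ≤ normFun R μ a := by
    refine le_normFun hR fun B hB haB => ?_
    obtain ⟨i, hi, hiB⟩ := (hεx.and (ha B hB haB)).exists
    exact hi.trans (normFun_le_setNorm hB hiB)
  obtain ⟨B, hB, hAB⟩ := hA (ε / 2) (half_pos hε)
  have key : ∀ z, ε ≤ normFun R μ z → (z ∈ A ↔ z ∈ B) := by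
    intro z hz
    by_contra hne
    have := hAB z (by rw [Set.mem_symmDiff]; tauto)
    linarith
  rw [coe_mem_starSet, key a hεa, eventually_congr (hεx.mono fun i hi => key (x i) hi)]
  refine ⟨fun h => ?_, fun h => ha B hB h⟩
  by_contra haB
  obtain ⟨i, hi, hi'⟩ := (h.and (ha Bᶜ (hR.compl_mem hB) haB)).exists
  exact hi' hi

lemma monad_antitone {τ σ : TopologicalSpace X} (h : τ ≤ σ) (a : X) :
    monad U τ a ⊆ monad U σ a := fun _ hy O hO => hy O (h O hO)

lemma mem_stPreimage_iff {τ : TopologicalSpace X} {A : Set X} {y : Star U X}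
    (hy : y ∈ nearstandard U τ) : y ∈ stPreimage U τ A ↔ standardPart U τ ⟨y, hy⟩ ∈ A := by
  simp [stPreimage, hy]

lemma standardPart_mem_monad {τ : TopologicalSpace X} (y : nearstandard U τ) :
    (y : Star U X) ∈ monad U τ (standardPart U τ y) := y.2.choose_spec

lemma le_generateFrom_of_eq_or_eq {τ : TopologicalSpace X}
    (hτ : τ = TopologicalSpace.generateFrom R ∨
      τ = TopologicalSpace.generateFrom (extendedRing R μ)) :
    τ ≤ TopologicalSpace.generateFrom R := by
  rcases hτ with rfl | rfl
  · exact le_rfl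
  · exact TopologicalSpace.generateFrom_anti subset_extendedRing

/-- The point found for the topology of `R` serves the finer one too, as membership in sets of the
extended ring passes from `a` to `y`. -/
lemma isLoebNull_compl_nearstandard [IsUltrametricDist K] {τ : TopologicalSpace X}
    (hτ : τ = TopologicalSpace.generateFrom R ∨
      τ = TopologicalSpace.generateFrom (extendedRing R μ))
    (hR : IsSetAlgebra R) (hμ : IsMeasure R μ) : IsLoebNull R μ (nearstandard U τ)ᶜ := by
  intro y hns
  by_contra hy
  obtain ⟨a, ha⟩ := exists_mem_monad_generateFrom hR hμ hy
  refine hns ⟨a, ?_⟩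
  rcases hτ with rfl | rfl
  · exact ha
  · have key := fun A (hA : A ∈ extendedRing R μ) =>
      (mem_starSet_iff_of_mem_monad hR hμ hy ha hA).mpr
    induction y using Germ.inductionOn with | _ x =>
    rw [coe_mem_monad, TopologicalSpace.tendsto_nhds_generateFrom_iff]
    exact key

lemma isLoebNull_symmDiff_starSet [IsUltrametricDist K] {τ : TopologicalSpace X}
    (hτ : τ = TopologicalSpace.generateFrom R ∨
      τ = TopologicalSpace.generateFrom (extendedRing R μ))
    (hR : IsSetAlgebra R) (hμ : IsMeasure R μ) {A : Set X} (hA : A ∈ extendedRing R μ) :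
    IsLoebNull R μ (symmDiff (stPreimage U τ A) (starSet U A)) := by
  intro y hyA
  by_contra hy
  have hns : y ∈ nearstandard U τ := by
    by_contra hns
    exact hy (isLoebNull_compl_nearstandard hτ hR hμ y hns)
  -- Both topologies refine that of `R`, so the chosen standard part lies in the right monad,
  -- whichever choice was made.
  have h := mem_starSet_iff_of_mem_monad hR hμ hy
    (monad_antitone (le_generateFrom_of_eq_or_eq hτ) _ (standardPart_mem_monad ⟨y, hns⟩)) hA
  rw [Set.mem_symmDiff, mem_stPreimage_iff hns] at hyA
  tauto

/-- Better and better approximations of a set, taken along an infinite index, give an internal set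
differing from its extension by a Loeb null set. -/
lemma isLoebNull_symmDiff_internalSet (hR : IsSetAlgebra R) (hμ : IsMeasure R μ) {A : Set X}
    {B : ℕ → Set X} (hAB : ∀ n, Approximates R μ A (B n) (1 / ((n : ℝ) + 1))) {n : I → ℕ}
    (hn : Tendsto n U atTop) :
    IsLoebNull R μ (symmDiff (starSet U A)
      (internalSet ((fun i => B (n i) : I → Set X) : Star U (Set X)))) := by
  have hconst : starSet U A = internalSet ((fun _ => A : I → Set X) : Star U (Set X)) := by
    ext y
    induction y using Germ.inductionOn with | _ x =>
    exact Iff.rfl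
  rw [hconst, internalSet_symmDiff]
  intro y
  induction y using Germ.inductionOn with | _ x =>
  intro hy
  rw [infinitesimal_starNormFun_coe hR hμ]
  refine squeeze_zero' (Eventually.of_forall fun i => normFun_nonneg (x i))
    ((coe_mem_internalSet.mp hy).mono fun i hi => hAB (n i) (x i) hi)
    (tendsto_one_div_add_atTop_nhds_zero_nat.comp hn)

end Ultrapower

end NonarchLoeb

theorem mainTheorem2 {I X K : Type*}
    [NontriviallyNormedField K] [IsUltrametricDist K] [CompleteSpace K]
    (U : Ultrafilter I) (hU : ¬ CountableInterFilter (U : Filter I))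
    (𝒜 : Set (Set X)) (h𝒜 : MeasureTheory.IsSetAlgebra 𝒜)
    (hsep : NonarchLoeb.IsCoveringSeparating 𝒜)
    (μ : Set X → K) (hμ : NonarchLoeb.IsMeasure 𝒜 μ)
    (hns : ∀ b ∈ NonarchLoeb.starRing U 𝒜,
      NonarchLoeb.starMeasure μ b ∈ NonarchLoeb.nearstandard U (inferInstance : TopologicalSpace K))
    (τ : TopologicalSpace X)
    (hτ : τ = TopologicalSpace.generateFrom 𝒜 ∨
      τ = TopologicalSpace.generateFrom (NonarchLoeb.extendedRing 𝒜 μ)) :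
    NonarchLoeb.IsLoebNull 𝒜 μ (NonarchLoeb.nearstandard U τ)ᶜ ∧
    (∀ A ∈ NonarchLoeb.extendedRing 𝒜 μ,
      NonarchLoeb.stPreimage U τ A ∈ NonarchLoeb.loebRing U 𝒜 μ) ∧
    (∀ A ∈ NonarchLoeb.extendedRing 𝒜 μ, ∃ c : K,
      NonarchLoeb.HasExtendedMeasure 𝒜 μ A c ∧
      NonarchLoeb.HasLoebMeasure 𝒜 μ (NonarchLoeb.stPreimage U τ A) c) := by
  have key : ∀ A ∈ NonarchLoeb.extendedRing 𝒜 μ, ∃ c : K,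
      NonarchLoeb.HasExtendedMeasure 𝒜 μ A c ∧
      NonarchLoeb.HasLoebMeasure 𝒜 μ (NonarchLoeb.stPreimage U τ A) c := by
    intro A hA
    choose B hB hAB using fun n : ℕ => hA (1 / ((n : ℝ) + 1)) (by positivity)
    obtain ⟨n, hn⟩ := NonarchLoeb.exists_tendsto_atTop hU
    obtain ⟨c, hc, hBc⟩ := NonarchLoeb.exists_hasExtendedMeasure h𝒜 hμ hA hB hAB
    set b : NonarchLoeb.Star U (Set X) := Germ.ofFun fun i => B (n i)
    have hb : b ∈ NonarchLoeb.starRing U 𝒜 := Eventually.of_forall fun i => hB (n i)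
    have hnull : NonarchLoeb.IsLoebNull 𝒜 μ
        (symmDiff (NonarchLoeb.stPreimage U τ A) (NonarchLoeb.internalSet b)) :=
      ((NonarchLoeb.isLoebNull_symmDiff_starSet hτ h𝒜 hμ hA).union
        (NonarchLoeb.isLoebNull_symmDiff_internalSet h𝒜 hμ hAB hn)).mono (symmDiff_triangle _ _ _)
    refine ⟨c, hc, ⟨b, hb, hnull⟩, fun d hd hdnull => ?_⟩
    -- Any admissible `d` differs from `b` by a null set, and `b` has measure near `c` since its
    -- index is infinite.
    refine NonarchLoeb.starMeasure_mem_monad_of_isLoebNull h𝒜 hμ hd hb ?_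
      (NonarchLoeb.coe_mem_monad.mpr (hBc.comp hn))
    refine (hdnull.union hnull).mono ?_
    rw [symmDiff_comm (NonarchLoeb.stPreimage U τ A) (NonarchLoeb.internalSet d)]
    exact symmDiff_triangle _ _ _
  refine ⟨NonarchLoeb.isLoebNull_compl_nearstandard hτ h𝒜 hμ, fun A hA => ?_, key⟩
  obtain ⟨c, -, hc⟩ := key A hA
  exact hc.1
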